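/- Let $0<\alpha<2$ and $0<|\rho_1|,|\rho_2|<1$. Let $(\boldsymbol{\varepsilon}_t)_{t\in\mathbb{Z}}$, $\boldsymbol{\varepsilon}_t=(\varepsilon_{1,t},\varepsilon_{2,t})$, be i.i.d. symmetric $\alpha$-stable (S$\alpha$S) random vectors in $\mathbb{R}^2$ with zero shift and (finite, symmetric) spectral measure $\Gamma_2$ on the Euclidean unit circle $S_2$, i.e. $\mathbb{E}\,e^{i\langle u,\boldsymbol{\varepsilon}_t\rangle}=\exp\{-\int_{S_2}|\langle u,s\rangle|^\alpha\,\Gamma_2(ds)\}$ for all $u\in\mathbb{R}^2$. Let $\boldsymbol{X}_t=(X_{1,t},X_{2,t})$, $t\in\mathbb{Z}$, be the strictly stationary process satisfying, almost surely for every $t\in\mathbb{Z}$, $$X_{1,t}=\rho_1X_{1,t+1}+\varepsilon_{1,t},\qquad X_{2,t}=\rho_2X_{2,t-1}+\varepsilon_{2,t}.$$ Let $\|\cdot\|$ be the seminorm $\|(x_1,x_2,x_3,x_4)\|=\sqrt{x_1^2+x_2^2}$ on $\mathbb{R}^4$ and $C_4^{\|\cdot\|}=\{s\in\mathbb{R}^4:\|s\|=1\}$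 its unit cylinder. Then, for every $t\in\mathbb{Z}$, the vector $\underline{\boldsymbol{X}}_t=(X_{1,t},X_{2,t},X_{1,t+1},X_{2,t+1})$ is S$\alpha$S, that is, its law is symmetric and, for independent copies $\underline{\boldsymbol{X}}^{(1)},\underline{\boldsymbol{X}}^{(2)}$ of $\underline{\boldsymbol{X}}_t$ and all $A,B>0$, $A\underline{\boldsymbol{X}}^{(1)}+B\underline{\boldsymbol{X}}^{(2)}$ has the law of $(A^\alpha+B^\alpha)^{1/\alpha}\,\underline{\boldsymbol{X}}_t+D$ for some non-random $D\in\mathbb{R}^4$. Moreover, $\underline{\boldsymbol{X}}_t$ is representable on $C_4^{\|\cdot\|}$, meaning that there is a symmetric Borel measure $\Gamma$ on $C_4^{\|\cdot\|}$ with $\int|\langle u,s\rangle|^\alpha\,\Gamma(ds)<\infty$ and $\mathbb{E}\,e^{i\langle u,\underline{\boldsymbol{X}}_t\rangle}=\exp\{-\int|\langle u,s\rangle|^\alpha\,\Gamma(ds)\}$ for all $u\in\mathbb{R}^4$, if and only if $$\Gamma_2\big(\{(0,-1),(0,+1)\}\big)=0.$$ -/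

import Mathlib

open MeasureTheory ProbabilityTheory

/-! Laws of random vectors are Borel measures on `EuclideanSpace ℝ (Fin d)`.
A measure "on" a Borel subset `S` of the space is a measure on the whole space that gives mass
zero to the complement of `S`. -/

/-- A measure on `ℝᵈ` is symmetric if it is invariant under `s ↦ -s`. -/
def IsSymmetricMeasure {d : ℕ} (ν : Measure (EuclideanSpace ℝ (Fin d))) : Prop :=
  ∀ A : Set (EuclideanSpace ℝ (Fin d)), MeasurableSet A → ν ((fun s => -s) ⁻¹' A) = ν A

/-- A probability law `ν` on `ℝᵈ` is `α`-stable if, for `X, X⁽¹⁾, X⁽²⁾` independent with law `ν`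
and for all `A, B > 0`, one has `A X⁽¹⁾ + B X⁽²⁾ = (A ^ α + B ^ α) ^ (1 / α) X + D` in law for some
non-random vector `D`. -/
def IsAlphaStable {d : ℕ} (α : ℝ) (ν : Measure (EuclideanSpace ℝ (Fin d))) : Prop :=
  IsProbabilityMeasure ν ∧
    ∀ A B : ℝ, 0 < A → 0 < B → ∃ D : EuclideanSpace ℝ (Fin d),
      (ν.prod ν).map (fun x => A • x.1 + B • x.2) =
        ν.map (fun x => ((A ^ α + B ^ α) ^ (1 / α)) • x + D)

/-- Symmetric `α`-stable (SαS) laws on `ℝᵈ`. -/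
def IsSymmetricAlphaStable {d : ℕ} (α : ℝ) (ν : Measure (EuclideanSpace ℝ (Fin d))) : Prop :=
  IsAlphaStable α ν ∧ IsSymmetricMeasure ν

/-- The law `ν` has characteristic function `u ↦ exp (- ∫ |⟨u, s⟩| ^ α Γ(ds))`, the integral being
finite for every `u`. -/
def HasSymmetricStableCharFun {d : ℕ} (α : ℝ) (ν Γ : Measure (EuclideanSpace ℝ (Fin d))) : Prop :=
  ∀ u : EuclideanSpace ℝ (Fin d),
    Integrable (fun s => |inner ℝ u s| ^ α) Γ ∧
      charFun ν u = Complex.exp (-((∫ s, |inner ℝ u s| ^ α ∂Γ : ℝ) : ℂ))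

/-- The law `ν` is SαS with zero shift vector and with the (finite, symmetric) spectral measure `Γ`
on the Euclidean unit sphere. -/
structure IsSymmetricAlphaStableWithSpectralMeasure {d : ℕ} (α : ℝ)
    (ν Γ : Measure (EuclideanSpace ℝ (Fin d))) : Prop where
  finite : IsFiniteMeasure Γ
  on_sphere : Γ (Metric.sphere (0 : EuclideanSpace ℝ (Fin d)) 1)ᶜ = 0
  symmetric : IsSymmetricMeasure Γ
  charFun_eq : HasSymmetricStableCharFun α ν Γ

/-- The unit cylinder `{s : ‖s‖ = 1}` of a seminorm on `ℝᵈ`. -/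
def unitCylinder {d : ℕ} (p : Seminorm ℝ (EuclideanSpace ℝ (Fin d))) :
    Set (EuclideanSpace ℝ (Fin d)) :=
  {s | p s = 1}

/-- Representability of an SαS law `ν` on the unit cylinder of the seminorm `p`: there is a
symmetric Borel measure on the cylinder which integrates `|⟨u, ·⟩| ^ α` for every `u` and yields
the characteristic function of `ν`. -/
def IsRepresentableOnCylinder {d : ℕ} (α : ℝ) (ν : Measure (EuclideanSpace ℝ (Fin d)))
    (p : Seminorm ℝ (EuclideanSpace ℝ (Fin d))) : Prop :=
  ∃ Γ : Measure (EuclideanSpace ℝ (Fin d)),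
    Γ (unitCylinder p)ᶜ = 0 ∧ IsSymmetricMeasure Γ ∧ HasSymmetricStableCharFun α ν Γ

/-- Strict stationarity of a process indexed by `ℤ`: its law as a process is shift invariant. -/
def IsStrictlyStationary {Ω E : Type*} [MeasurableSpace Ω] [MeasurableSpace E]
    (P : Measure Ω) (X : ℤ → Ω → E) : Prop :=
  ∀ h : ℤ, IdentDistrib (fun ω (t : ℤ) => X (t + h) ω) (fun ω (t : ℤ) => X t ω) P P

/-- `X` is the strictly stationary bivariate process whose first component is an anticipative AR(1)
and whose second component is a causal AR(1), driven by the i.i.d. SαS errors `ε` with spectral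
measure `Γ₂`. -/
structure IsBivariateStableAR1 {Ω : Type*} [MeasurableSpace Ω] (P : Measure Ω) (α ρ₁ ρ₂ : ℝ)
    (Γ₂ : Measure (EuclideanSpace ℝ (Fin 2))) (ε X : ℤ → Ω → EuclideanSpace ℝ (Fin 2)) :
    Prop where
  measurable_error : ∀ t, Measurable (ε t)
  indep_error : iIndepFun ε P
  law_error : ∀ t, IsSymmetricAlphaStableWithSpectralMeasure α (P.map (ε t)) Γ₂
  measurable : ∀ t, Measurable (X t)
  stationary : IsStrictlyStationary P X
  anticipative : ∀ t, ∀ᵐ ω ∂P, X t ω 0 = ρ₁ * X (t + 1) ω 0 + ε t ω 0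
  causal : ∀ t, ∀ᵐ ω ∂P, X t ω 1 = ρ₂ * X (t - 1) ω 1 + ε t ω 1

/-- The vector `(X_t, X_{t+1})` of `ℝ⁴`. -/
def stackedVector {Ω : Type*} (X : ℤ → Ω → EuclideanSpace ℝ (Fin 2)) (t : ℤ) (ω : Ω) :
    EuclideanSpace ℝ (Fin 4) :=
  !₂[X t ω 0, X t ω 1, X (t + 1) ω 0, X (t + 1) ω 1]

/-- The seminorm `(x₁, x₂, x₃, x₄) ↦ √(x₁² + x₂²)` on `ℝ⁴`. -/
noncomputable def presentSeminorm : Seminorm ℝ (EuclideanSpace ℝ (Fin 4)) :=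
  Seminorm.of (fun x => √(x 0 ^ 2 + x 1 ^ 2))
    (fun x y => by
      have h := norm_add_le (!₂[x 0, x 1] : EuclideanSpace ℝ (Fin 2)) !₂[y 0, y 1]
      simpa [EuclideanSpace.norm_eq, Fin.sum_univ_two] using h)
    (fun a x => by
      have h := norm_smul a (!₂[x 0, x 1] : EuclideanSpace ℝ (Fin 2))
      simpa [EuclideanSpace.norm_eq, Fin.sum_univ_two, mul_pow, sq_abs] using h)

/-! Iterating the two recursions in opposite time directions writes the stacked vector as a finite
sum of independent terms `arFilter ρ₁ ρ₂ j (ε (t + j))` plus remainders `ρ ^ n` times a value of the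
process. By stationarity these remainders vanish in law, so the characteristic function is `exp (-∫
|⟨u, s⟩| ^ α Λ(ds))`, where Λ is the sum over `j` of the images of Γ₂ under `arFilter`
(`IsBivariateStableAR1.hasSymmetricStableCharFun`). Homogeneity of the exponent gives the SαS
property.

The kernel of the seminorm is the plane `x₁ = x₂ = 0`. The only nonzero vectors of it that Λ can
charge come from `j = 1`, where `(0, ±1)` is sent to `(0, 0, 0, ±1)`: the error in the causal
component at time `t + 1` is invisible at time `t`. If Γ₂ does not charge `(0, ±1)`, dividing each
`s` by its seminorm `p s` and weighting by `p s ^ α` carries Λ to the cylinder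
(`HasSymmetricStableCharFun.isRepresentableOnCylinder`).

Conversely, a representing measure Γ on the cylinder and Λ have the same integrals of `|⟨u, s⟩| ^
α`. Full uniqueness of spectral measures is not needed: since `α < 2`, second differences in `u` at
`w`, divided by `h ^ α`, isolate the hyperplane orthogonal to `w`, and a suitable sequence of
hyperplanes isolates a coordinate axis (`setIntegral_axis_eq_of_integral_abs_inner_rpow_eq`). Γ
gives no mass to the last axis, where the seminorm vanishes, so Λ charges it at most at the origin.
-/

open Filter Topology

/-! ### Second differences of `|x| ^ α` -/

/-- The second difference `|x + h| ^ α + |x - h| ^ α - 2 |x| ^ α`. -/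
noncomputable def absRpowSecondDiff (α x h : ℝ) : ℝ :=
  |x + h| ^ α + |x - h| ^ α - 2 * |x| ^ α

lemma abs_rpow_eq_sq_rpow (α x : ℝ) : |x| ^ α = (x ^ 2) ^ (α / 2) := by
  rw [← sq_abs, ← Real.rpow_natCast, ← Real.rpow_mul (abs_nonneg x)]
  congr 1
  push_cast
  ring

/-- Concavity of `t ↦ t ^ (α / 2)` at the points `(x + h) ^ 2` and `(x - h) ^ 2`, whose mean is `x ^
2 + h ^ 2`. -/
lemma abs_add_rpow_add_abs_sub_rpow_le {α : ℝ} (hα₀ : 0 < α) (hα₂ : α < 2) (x h : ℝ) :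
    |x + h| ^ α + |x - h| ^ α ≤ 2 * (x ^ 2 + h ^ 2) ^ (α / 2) := by
  have hc := (Real.concaveOn_rpow (p := α / 2) (by linarith) (by linarith)).2
    (Set.mem_Ici.2 (sq_nonneg (x + h))) (Set.mem_Ici.2 (sq_nonneg (x - h)))
    (show (0 : ℝ) ≤ 1 / 2 by norm_num) (show (0 : ℝ) ≤ 1 / 2 by norm_num) (by norm_num)
  simp only [smul_eq_mul] at hc
  rw [show 1 / 2 * (x + h) ^ 2 + 1 / 2 * (x - h) ^ 2 = x ^ 2 + h ^ 2 by ring] at hc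
  rw [abs_rpow_eq_sq_rpow, abs_rpow_eq_sq_rpow]
  linarith

lemma absRpowSecondDiff_le {α : ℝ} (hα₀ : 0 < α) (hα₂ : α < 2) (x h : ℝ) :
    absRpowSecondDiff α x h ≤ 2 * |h| ^ α := by
  have h1 := abs_add_rpow_add_abs_sub_rpow_le hα₀ hα₂ x h
  have h2 := Real.rpow_add_le_add_rpow (sq_nonneg x) (sq_nonneg h) (p := α / 2) (by linarith)
    (by linarith)
  rw [← abs_rpow_eq_sq_rpow, ← abs_rpow_eq_sq_rpow] at h2
  rw [absRpowSecondDiff]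
  linarith

lemma absRpowSecondDiff_le_sq {α : ℝ} (hα₀ : 0 < α) (hα₂ : α < 2) {x : ℝ} (hx : x ≠ 0) (h : ℝ) :
    absRpowSecondDiff α x h ≤ 2 * |x| ^ α * (h / x) ^ 2 := by
  have h1 := abs_add_rpow_add_abs_sub_rpow_le hα₀ hα₂ x h
  rw [show x ^ 2 + h ^ 2 = x ^ 2 * (1 + (h / x) ^ 2) by field_simp,
    Real.mul_rpow (sq_nonneg x) (by positivity), ← abs_rpow_eq_sq_rpow] at h1
  have h2 := rpow_one_add_le_one_add_mul_self (s := (h / x) ^ 2) (by nlinarith)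
    (p := α / 2) (by linarith) (by linarith)
  have h3 : (1 + (h / x) ^ 2) ^ (α / 2) ≤ 1 + (h / x) ^ 2 := by
    nlinarith [sq_nonneg (h / x)]
  have h4 := mul_le_mul_of_nonneg_left h3 (by positivity : 0 ≤ |x| ^ α)
  rw [absRpowSecondDiff]
  linarith

lemma neg_sq_le_absRpowSecondDiff {α : ℝ} (hα₂ : α < 2) {x h : ℝ} (hx : x ≠ 0)
    (hxh : |h| ≤ |x|) : -(2 * |x| ^ α * (h / x) ^ 2) ≤ absRpowSecondDiff α x h := by
  have hsq : h ^ 2 ≤ x ^ 2 := sq_le_sq.2 hxh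
  have ht : (h / x) ^ 2 ≤ 1 := by
    rw [div_pow]
    exact div_le_one_of_le₀ hsq (sq_nonneg x)
  -- `q ^ 2` is the product of the two powers, so AM-GM bounds their sum below by `2 * q`; then `y ≤
  -- y ^ (α / 2)` on `[0, 1]` bounds `q`.
  set q : ℝ := (x ^ 2 - h ^ 2) ^ (α / 2) with hq
  have hq0 : 0 ≤ q := Real.rpow_nonneg (by linarith) _
  have hprod : |x + h| ^ α * |x - h| ^ α = q ^ 2 := by
    rw [← Real.mul_rpow (abs_nonneg _) (abs_nonneg _), ← abs_mul,
      show (x + h) * (x - h) = x ^ 2 - h ^ 2 by ring, abs_of_nonneg (sub_nonneg.2 hsq), hq,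
      ← Real.rpow_mul_natCast (sub_nonneg.2 hsq)]
    congr 1
    push_cast
    ring
  have hsum : 2 * q ≤ |x + h| ^ α + |x - h| ^ α := by
    have hA : 0 ≤ |x + h| ^ α := by positivity
    have hB : 0 ≤ |x - h| ^ α := by positivity
    nlinarith [sq_nonneg (|x + h| ^ α - |x - h| ^ α)]
  have hlow : |x| ^ α * (1 - (h / x) ^ 2) ≤ q := by
    rw [hq, show x ^ 2 - h ^ 2 = x ^ 2 * (1 - (h / x) ^ 2) by field_simp,
      Real.mul_rpow (sq_nonneg x) (by linarith), ← abs_rpow_eq_sq_rpow]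
    refine mul_le_mul_of_nonneg_left ?_ (by positivity)
    exact Real.self_le_rpow_of_le_one (by linarith) (by nlinarith [sq_nonneg (h / x)])
      (by linarith)
  rw [absRpowSecondDiff]
  linarith

/-- Uniform in `x`, hence the majorant for dominated convergence. The lower bound is the quadratic
one if `|h| ≤ |x|`; otherwise `|x| ^ α ≤ |h| ^ α` and the other two terms are nonnegative. -/
lemma abs_absRpowSecondDiff_le {α : ℝ} (hα₀ : 0 < α) (hα₂ : α < 2) (x h : ℝ) :
    |absRpowSecondDiff α x h| ≤ 2 * |h| ^ α := by
  refine abs_le.2 ⟨?_, absRpowSecondDiff_le hα₀ hα₂ x h⟩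
  rcases le_total |h| |x| with hxh | hxh
  · rcases eq_or_ne x 0 with rfl | hx
    · have : h = 0 := by simpa using hxh
      simp [absRpowSecondDiff, this, Real.zero_rpow hα₀.ne']
    refine le_trans ?_ (neg_sq_le_absRpowSecondDiff hα₂ hx hxh)
    have ht : |h / x| ≤ 1 := by
      rw [abs_div]
      exact div_le_one_of_le₀ hxh (abs_nonneg x)
    have h1 : (h / x) ^ 2 ≤ |h / x| ^ α := by
      rw [← sq_abs, ← Real.rpow_natCast]
      exact Real.rpow_le_rpow_of_exponent_ge' (abs_nonneg _) ht hα₀.le (by push_cast; linarith)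
    have h2 : |h| ^ α = |x| ^ α * |h / x| ^ α := by
      rw [← Real.mul_rpow (abs_nonneg _) (abs_nonneg _), ← abs_mul, mul_div_cancel₀ _ hx]
    rw [h2]
    have h3 := mul_le_mul_of_nonneg_left h1 (by positivity : 0 ≤ |x| ^ α)
    linarith
  · have h1 : |x| ^ α ≤ |h| ^ α := Real.rpow_le_rpow (abs_nonneg _) hxh hα₀.le
    have hA : 0 ≤ |x + h| ^ α := by positivity
    have hB : 0 ≤ |x - h| ^ α := by positivity
    rw [absRpowSecondDiff]
    linarith

lemma tendsto_absRpowSecondDiff_div {α : ℝ} (hα₀ : 0 < α) (hα₂ : α < 2) {x : ℝ} (hx : x ≠ 0)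
    (y : ℝ) :
    Tendsto (fun h : ℝ => absRpowSecondDiff α x (h * y) / h ^ α) (𝓝[>] 0) (𝓝 0) := by
  have hpow : Tendsto (fun h : ℝ => h ^ (2 - α)) (𝓝[>] 0) (𝓝 0) := by
    have := (Real.continuousAt_rpow_const 0 (2 - α) (Or.inr (by linarith))).tendsto
    rw [Real.zero_rpow (by linarith)] at this
    exact this.mono_left nhdsWithin_le_nhds
  have hbound : Tendsto (fun h : ℝ => 2 * |x| ^ α * (y / x) ^ 2 * h ^ (2 - α)) (𝓝[>] 0) (𝓝 0) := by
    simpa using hpow.const_mul (2 * |x| ^ α * (y / x) ^ 2)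
  refine squeeze_zero_norm' ?_ hbound
  have hsmall : ∀ᶠ h : ℝ in 𝓝[>] 0, |h * y| < |x| := by
    have hc : Tendsto (fun h : ℝ => |h * y|) (𝓝 0) (𝓝 0) := by
      have : Continuous fun h : ℝ => |h * y| := by fun_prop
      simpa using this.tendsto 0
    exact (hc.mono_left nhdsWithin_le_nhds).eventually_lt_const (abs_pos.2 hx)
  filter_upwards [hsmall, self_mem_nhdsWithin] with h hh hpos
  have hpos : 0 < h := hpos
  have h1 : |absRpowSecondDiff α x (h * y)| ≤ 2 * |x| ^ α * (h * y / x) ^ 2 :=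
    abs_le.2 ⟨neg_sq_le_absRpowSecondDiff hα₂ hx hh.le, absRpowSecondDiff_le_sq hα₀ hα₂ hx _⟩
  rw [Real.norm_eq_abs, abs_div, abs_of_pos (Real.rpow_pos_of_pos hpos α),
    div_le_iff₀ (Real.rpow_pos_of_pos hpos α), mul_assoc _ (h ^ (2 - α)),
    ← Real.rpow_add hpos, show 2 - α + α = ((2 : ℕ) : ℝ) by push_cast; ring, Real.rpow_natCast]
  refine h1.trans_eq ?_
  ring

/-! ### Recovering the mass on hyperplanes and coordinate axes -/

/-- The integrals `∫ |⟨u, s⟩| ^ α μ(ds)` determine, for each `w`, the integral of `|⟨e, s⟩| ^ α`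
over the hyperplane orthogonal to `w`. -/
lemma tendsto_integral_secondDiff {E : Type*} [NormedAddCommGroup E] [InnerProductSpace ℝ E]
    [MeasurableSpace E] [BorelSpace E] [SecondCountableTopology E] {α : ℝ} (hα₀ : 0 < α)
    (hα₂ : α < 2) {μ : Measure E} (hμ : ∀ u : E, Integrable (fun s => |inner ℝ u s| ^ α) μ)
    (w e : E) :
    Tendsto (fun h : ℝ => (∫ s, |inner ℝ (w + h • e) s| ^ α ∂μ +
        ∫ s, |inner ℝ (w - h • e) s| ^ α ∂μ - 2 * ∫ s, |inner ℝ w s| ^ α ∂μ) / h ^ α)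
      (𝓝[>] 0) (𝓝 (2 * ∫ s in {s | inner ℝ w s = 0}, |inner ℝ e s| ^ α ∂μ)) := by
  have hmeas : MeasurableSet {s : E | inner ℝ w s = 0} :=
    measurableSet_eq_fun (by fun_prop) (by fun_prop)
  have heq : ∀ h : ℝ, (∫ s, |inner ℝ (w + h • e) s| ^ α ∂μ +
        ∫ s, |inner ℝ (w - h • e) s| ^ α ∂μ - 2 * ∫ s, |inner ℝ w s| ^ α ∂μ) / h ^ α =
      ∫ s, absRpowSecondDiff α (inner ℝ w s) (h * inner ℝ e s) / h ^ α ∂μ := by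
    intro h
    rw [integral_div, ← integral_const_mul, ← integral_add (hμ _) (hμ _),
      ← integral_sub (Integrable.fun_add (hμ _) (hμ _)) ((hμ _).const_mul 2)]
    simp only [absRpowSecondDiff, inner_add_left, inner_sub_left, real_inner_smul_left]
  rw [funext heq, ← integral_indicator hmeas, ← integral_const_mul]
  refine tendsto_integral_filter_of_dominated_convergence (fun s => 2 * |inner ℝ e s| ^ α)
    ?_ ?_ ((hμ e).const_mul 2) ?_
  · refine Eventually.of_forall fun h => Measurable.aestronglyMeasurable ?_
    unfold absRpowSecondDiff
    fun_prop
  · filter_upwards [self_mem_nhdsWithin] with h hpos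
    have hpos : 0 < h := hpos
    refine Eventually.of_forall fun s => ?_
    rw [Real.norm_eq_abs, abs_div, abs_of_pos (Real.rpow_pos_of_pos hpos α),
      div_le_iff₀ (Real.rpow_pos_of_pos hpos α)]
    refine (abs_absRpowSecondDiff_le hα₀ hα₂ _ _).trans_eq ?_
    rw [abs_mul, Real.mul_rpow (abs_nonneg _) (abs_nonneg _), abs_of_pos hpos]
    ring
  · refine Eventually.of_forall fun s => ?_
    -- On the hyperplane the quotient is constant in `h`; off it the second difference is `O(h ^
    -- 2)`, which is negligible against `h ^ α`.
    by_cases hs : inner ℝ w s = 0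
    · rw [Set.indicator_of_mem (show s ∈ {s : E | inner ℝ w s = 0} from hs)]
      refine tendsto_const_nhds.congr' ?_
      filter_upwards [self_mem_nhdsWithin] with h hpos
      have hpos : 0 < h := hpos
      rw [hs, absRpowSecondDiff, zero_add, zero_sub, abs_neg, abs_zero, Real.zero_rpow hα₀.ne',
        abs_mul, Real.mul_rpow (abs_nonneg _) (abs_nonneg _), abs_of_pos hpos]
      field_simp [(Real.rpow_pos_of_pos hpos α).ne']
      ring
    · rw [Set.indicator_of_notMem (show s ∉ {s : E | inner ℝ w s = 0} from hs), mul_zero]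
      exact tendsto_absRpowSecondDiff_div hα₀ hα₂ hs _

/-- The vector of `ℝᵈ` with `j`-th coordinate `n ^ j` for `j ≠ i` and `i`-th coordinate `0`. -/
noncomputable def puncturedMomentVector {d : ℕ} (i : Fin d) (n : ℕ) : EuclideanSpace ℝ (Fin d) :=
  WithLp.toLp 2 fun j => if j = i then 0 else (n : ℝ) ^ (j : ℕ)

/-- The inner product is a polynomial in `n` whose coefficients are the coordinates of `s` other
than the `i`-th; being nonzero, it has finitely many roots. -/
lemma eventually_inner_puncturedMomentVector_ne_zero {d : ℕ} (i : Fin d)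
    {s : EuclideanSpace ℝ (Fin d)} (hs : ∃ j, j ≠ i ∧ s j ≠ 0) :
    ∀ᶠ n in atTop, inner ℝ (puncturedMomentVector i n) s ≠ 0 := by
  classical
  let p : Polynomial ℝ :=
    ∑ j : Fin d, Polynomial.monomial (j : ℕ) (if j = i then 0 else s j)
  have hcoeff : ∀ k : Fin d, p.coeff k = if k = i then 0 else s k := by
    intro k
    simp only [p, Polynomial.finsetSum_coeff, Polynomial.coeff_monomial, Fin.val_inj]
    simp
  have hp : p ≠ 0 := by
    obtain ⟨j, hj, hsj⟩ := hs
    intro h0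
    have := hcoeff j
    rw [h0, if_neg hj] at this
    exact hsj (by simpa using this.symm)
  have hinner : ∀ n : ℕ, inner ℝ (puncturedMomentVector i n) s = p.eval (n : ℝ) := by
    intro n
    simp only [p, Polynomial.eval_finsetSum, Polynomial.eval_monomial, PiLp.inner_apply,
      puncturedMomentVector]
    refine Finset.sum_congr rfl fun j _ => ?_
    split_ifs <;> simp
  have hfin : {n : ℕ | p.eval (n : ℝ) = 0}.Finite := by
    have := (p.roots.toFinset.finite_toSet).preimage (f := ((↑) : ℕ → ℝ))
      Nat.cast_injective.injOn
    refine this.subset fun n hn => ?_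
    simpa [hp] using hn
  have := hfin.eventually_cofinite_notMem
  rw [Nat.cofinite_eq_atTop] at this
  filter_upwards [this] with n hn
  rw [hinner]
  exact hn

lemma tendsto_setIntegral_inner_puncturedMomentVector {d : ℕ} {α : ℝ} (i : Fin d)
    {μ : Measure (EuclideanSpace ℝ (Fin d))} (hμ : Integrable (fun s => |s i| ^ α) μ) :
    Tendsto (fun n : ℕ => ∫ s in {s | inner ℝ (puncturedMomentVector i n) s = 0}, |s i| ^ α ∂μ)
      atTop (𝓝 (∫ s in {s | ∀ j, j ≠ i → s j = 0}, |s i| ^ α ∂μ)) := by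
  have hmeas : ∀ n, MeasurableSet {s : EuclideanSpace ℝ (Fin d) |
      inner ℝ (puncturedMomentVector i n) s = 0} := fun n =>
    measurableSet_eq_fun (by fun_prop) (by fun_prop)
  have hmeas' : MeasurableSet {s : EuclideanSpace ℝ (Fin d) | ∀ j, j ≠ i → s j = 0} := by
    simp only [Set.ofPred_forall]
    exact MeasurableSet.iInter fun j => MeasurableSet.iInter fun _ =>
      measurableSet_eq_fun (by fun_prop) (by fun_prop)
  simp_rw [fun n => (integral_indicator (μ := μ) (f := fun s => |s i| ^ α) (hmeas n)).symm]
  rw [← integral_indicator hmeas']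
  refine tendsto_integral_of_dominated_convergence (fun s => |s i| ^ α) (fun n => ?_) hμ
    (fun n => ?_) ?_
  · exact (Measurable.indicator (by fun_prop) (hmeas n)).aestronglyMeasurable
  · refine Eventually.of_forall fun s => (norm_indicator_le_norm_self _ s).trans_eq ?_
    exact Real.norm_of_nonneg (by positivity)
  · refine Eventually.of_forall fun s => ?_
    refine tendsto_const_nhds.congr' ?_
    by_cases hs : ∀ j, j ≠ i → s j = 0
    · refine Eventually.of_forall fun n => ?_
      rw [Set.indicator_of_mem (show s ∈ {s : EuclideanSpace ℝ (Fin d) | ∀ j, j ≠ i → s j = 0}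
        from hs)]
      refine (Set.indicator_of_mem ?_ (fun s : EuclideanSpace ℝ (Fin d) => |s i| ^ α)).symm
      rw [Set.mem_ofPred_eq, PiLp.inner_apply]
      refine Finset.sum_eq_zero fun j _ => ?_
      by_cases hj : j = i
      · simp [puncturedMomentVector, hj]
      · simp [hs j hj]
    · have hs' := hs
      push Not at hs'
      filter_upwards [eventually_inner_puncturedMomentVector_ne_zero i hs'] with n hn
      rw [Set.indicator_of_notMem (show s ∉ {s : EuclideanSpace ℝ (Fin d) |
        ∀ j, j ≠ i → s j = 0} from hs)]
      exact (Set.indicator_of_notMem (show s ∉ {s : EuclideanSpace ℝ (Fin d) |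
        inner ℝ (puncturedMomentVector i n) s = 0} from hn) (fun s : EuclideanSpace ℝ (Fin d) => |s i| ^ α)).symm

/-- The integrals `∫ |⟨u, s⟩| ^ α μ(ds)` determine the mass that `|s i| ^ α μ(ds)` puts on the
`i`-th coordinate axis. -/
theorem setIntegral_axis_eq_of_integral_abs_inner_rpow_eq {d : ℕ} {α : ℝ} (hα₀ : 0 < α)
    (hα₂ : α < 2) {μ ν : Measure (EuclideanSpace ℝ (Fin d))}
    (hμ : ∀ u : EuclideanSpace ℝ (Fin d), Integrable (fun s => |inner ℝ u s| ^ α) μ)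
    (hν : ∀ u : EuclideanSpace ℝ (Fin d), Integrable (fun s => |inner ℝ u s| ^ α) ν)
    (h : ∀ u : EuclideanSpace ℝ (Fin d),
      ∫ s, |inner ℝ u s| ^ α ∂μ = ∫ s, |inner ℝ u s| ^ α ∂ν) (i : Fin d) :
    ∫ s in {s | ∀ j, j ≠ i → s j = 0}, |s i| ^ α ∂μ =
      ∫ s in {s | ∀ j, j ≠ i → s j = 0}, |s i| ^ α ∂ν := by
  have hi : ∀ s : EuclideanSpace ℝ (Fin d), inner ℝ (EuclideanSpace.single i (1 : ℝ)) s = s i :=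
    fun s => by simp [EuclideanSpace.inner_single_left]
  have hyper : ∀ w : EuclideanSpace ℝ (Fin d),
      ∫ s in {s | inner ℝ w s = 0}, |s i| ^ α ∂μ = ∫ s in {s | inner ℝ w s = 0}, |s i| ^ α ∂ν := by
    intro w
    have h1 := tendsto_integral_secondDiff hα₀ hα₂ hμ w (EuclideanSpace.single i (1 : ℝ))
    have h2 := tendsto_integral_secondDiff hα₀ hα₂ hν w (EuclideanSpace.single i (1 : ℝ))
    simp_rw [h] at h1
    simp_rw [hi] at h1 h2
    linarith [tendsto_nhds_unique h1 h2]
  have h1 := tendsto_setIntegral_inner_puncturedMomentVector (α := α) i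
    (by simpa only [hi] using hμ (EuclideanSpace.single i (1 : ℝ)))
  have h2 := tendsto_setIntegral_inner_puncturedMomentVector (α := α) i
    (by simpa only [hi] using hν (EuclideanSpace.single i (1 : ℝ)))
  simp_rw [hyper] at h1
  exact tendsto_nhds_unique h1 h2

/-! ### Symmetric measures and stable characteristic functions -/

lemma IsSymmetricMeasure.map_neg_eq {d : ℕ} {ν : Measure (EuclideanSpace ℝ (Fin d))}
    (h : IsSymmetricMeasure ν) : ν.map (fun s => -s) = ν := by
  ext A hA
  rw [Measure.map_apply measurable_neg hA, h A hA]

lemma isSymmetricMeasure_of_map_neg_eq {d : ℕ} {ν : Measure (EuclideanSpace ℝ (Fin d))}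
    (h : ν.map (fun s => -s) = ν) : IsSymmetricMeasure ν := by
  intro A hA
  rw [← Measure.map_apply measurable_neg hA, h]

lemma IsSymmetricMeasure.map {d d' : ℕ} {ν : Measure (EuclideanSpace ℝ (Fin d))}
    (h : IsSymmetricMeasure ν) (T : EuclideanSpace ℝ (Fin d) →L[ℝ] EuclideanSpace ℝ (Fin d')) :
    IsSymmetricMeasure (ν.map T) := by
  refine isSymmetricMeasure_of_map_neg_eq ?_
  rw [Measure.map_map measurable_neg T.measurable]
  conv_rhs => rw [← h.map_neg_eq, Measure.map_map T.measurable measurable_neg]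
  congr 1
  ext1 s
  simp

lemma IsSymmetricMeasure.sum {d : ℕ} {ι : Type*} {Γ : ι → Measure (EuclideanSpace ℝ (Fin d))}
    (h : ∀ i, IsSymmetricMeasure (Γ i)) : IsSymmetricMeasure (Measure.sum Γ) := by
  intro A hA
  rw [Measure.sum_apply _ (measurable_neg hA), Measure.sum_apply _ hA]
  exact tsum_congr fun i => h i A hA

lemma HasSymmetricStableCharFun.map {d d' : ℕ} {α : ℝ}
    {ν Γ : Measure (EuclideanSpace ℝ (Fin d))} (h : HasSymmetricStableCharFun α ν Γ)
    (T : EuclideanSpace ℝ (Fin d) →L[ℝ] EuclideanSpace ℝ (Fin d')) :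
    HasSymmetricStableCharFun α (ν.map T) (Γ.map T) := by
  intro u
  have hinner : ∀ s, inner ℝ u (T s) = inner ℝ (ContinuousLinearMap.adjoint T u) s := fun s =>
    (ContinuousLinearMap.adjoint_inner_left T s u).symm
  have hmeas : Measurable fun s : EuclideanSpace ℝ (Fin d') => |inner ℝ u s| ^ α := by fun_prop
  obtain ⟨hint, hchar⟩ := h (ContinuousLinearMap.adjoint T u)
  constructor
  · rw [integrable_map_measure hmeas.aestronglyMeasurable T.measurable.aemeasurable]
    simpa only [Function.comp_def, hinner] using hint
  · rw [integral_map T.measurable.aemeasurable hmeas.aestronglyMeasurable]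
    simp_rw [hinner]
    rw [← hchar, charFun_apply, charFun_apply, integral_map T.measurable.aemeasurable]
    · simp_rw [real_inner_comm u, hinner, real_inner_comm (ContinuousLinearMap.adjoint T u)]
    · exact Measurable.aestronglyMeasurable (by fun_prop)

/-- Only the characteristic functions of partial sums have to converge, and only along one
exhausting sequence of finite sets: the exponents are summable, so the order of summation is
immaterial. -/
theorem HasSymmetricStableCharFun.sum_of_tendsto {d : ℕ} {α : ℝ} {ι : Type*} [Countable ι]
    {ν : Measure (EuclideanSpace ℝ (Fin d))} {Γ : ι → Measure (EuclideanSpace ℝ (Fin d))}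
    {J : ℕ → Finset ι} (hJ : Tendsto J atTop atTop)
    (hint : ∀ i (u : EuclideanSpace ℝ (Fin d)), Integrable (fun s => |inner ℝ u s| ^ α) (Γ i))
    (hsum : ∀ u : EuclideanSpace ℝ (Fin d), Summable fun i => ∫ s, |inner ℝ u s| ^ α ∂Γ i)
    (hlim : ∀ u : EuclideanSpace ℝ (Fin d), Tendsto
      (fun n => ∏ i ∈ J n, Complex.exp (-((∫ s, |inner ℝ u s| ^ α ∂Γ i : ℝ) : ℂ))) atTop
      (𝓝 (charFun ν u))) :
    HasSymmetricStableCharFun α ν (Measure.sum Γ) := by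
  intro u
  have hint' : Integrable (fun s => |inner ℝ u s| ^ α) (Measure.sum Γ) := by
    refine integrable_sum_measure (fun i => hint i u) ?_
    refine (hsum u).congr fun i => integral_congr_ae (Eventually.of_forall fun s => ?_)
    exact (Real.norm_of_nonneg (by positivity)).symm
  refine ⟨hint', tendsto_nhds_unique (hlim u) ?_⟩
  have h1 := (hasSum_integral_measure hint').comp hJ
  have h2 := (Complex.continuous_exp.tendsto _).comp
    ((Complex.continuous_ofReal.tendsto _).comp h1).neg
  refine h2.congr fun n => ?_
  simp [← Complex.exp_sum]

/-- The exponent is even and homogeneous of degree `α` in `u`, so the shift `D = 0` works. -/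
theorem HasSymmetricStableCharFun.isSymmetricAlphaStable {d : ℕ} {α : ℝ} (hα : 0 < α)
    {ν Γ : Measure (EuclideanSpace ℝ (Fin d))} [IsProbabilityMeasure ν]
    (h : HasSymmetricStableCharFun α ν Γ) : IsSymmetricAlphaStable α ν := by
  have hsmul : ∀ (c : ℝ) (u : EuclideanSpace ℝ (Fin d)), charFun ν (c • u) =
      Complex.exp (-((|c| ^ α * ∫ s, |inner ℝ u s| ^ α ∂Γ : ℝ) : ℂ)) := by
    intro c u
    rw [(h (c • u)).2, ← integral_const_mul]
    simp_rw [real_inner_smul_left, abs_mul, Real.mul_rpow (abs_nonneg _) (abs_nonneg _)]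
  refine ⟨⟨inferInstance, fun A B hA hB => ⟨0, ?_⟩⟩, isSymmetricMeasure_of_map_neg_eq ?_⟩
  · have hsplit : (ν.prod ν).map (fun x => A • x.1 + B • x.2) =
        ((ν.map (A • ·)).prod (ν.map (B • ·))).map (fun x => x.1 + x.2) := by
      rw [Measure.map_prod_map _ _ (measurable_const_smul A) (measurable_const_smul B),
        Measure.map_map (by fun_prop) (by fun_prop)]
      rfl
    have hprob : ∀ c : ℝ, IsProbabilityMeasure (ν.map (c • ·)) := fun c =>
      Measure.isProbabilityMeasure_map (by fun_prop)
    have := hprob A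
    have := hprob B
    simp only [add_zero]
    have hAB : 0 ≤ A ^ α + B ^ α := by positivity
    refine Measure.ext_of_charFun (funext fun u => ?_)
    rw [hsplit, charFun_map_add_prod_eq_mul, Pi.mul_apply, charFun_map_smul, charFun_map_smul,
      charFun_map_smul, hsmul, hsmul, hsmul, ← Complex.exp_add, abs_of_pos hA, abs_of_pos hB,
      abs_of_nonneg (Real.rpow_nonneg hAB _), ← Real.rpow_mul hAB, one_div_mul_cancel hα.ne',
      Real.rpow_one]
    congr 1
    push_cast
    ring
  · have : IsProbabilityMeasure (ν.map fun s => -s) :=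
      Measure.isProbabilityMeasure_map (by fun_prop)
    have hneg : (fun s : EuclideanSpace ℝ (Fin d) => -s) = fun s => (-1 : ℝ) • s := by
      ext1 s
      simp
    refine Measure.ext_of_charFun (funext fun u => ?_)
    rw [hneg, charFun_map_smul, hsmul, (h u).2]
    simp

/-! ### Representability on a cylinder -/

/-- A symmetric spectral measure on `ℝᵈ` which does not charge the nonzero vectors of zero seminorm
can be projected radially onto the unit cylinder. -/
theorem HasSymmetricStableCharFun.isRepresentableOnCylinder {d : ℕ} {α : ℝ} (hα : 0 < α)
    {ν Λ : Measure (EuclideanSpace ℝ (Fin d))} (h : HasSymmetricStableCharFun α ν Λ)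
    (hsymm : IsSymmetricMeasure Λ) {p : Seminorm ℝ (EuclideanSpace ℝ (Fin d))} (hp : Continuous p)
    (hnull : Λ {s | s ≠ 0 ∧ p s = 0} = 0) : IsRepresentableOnCylinder α ν p := by
  have hpm : Measurable p := hp.measurable
  have hdens : Measurable fun s => ENNReal.ofReal (p s ^ α) := by fun_prop
  have hproj : Measurable fun s : EuclideanSpace ℝ (Fin d) => (p s)⁻¹ • s := by fun_prop
  have hcyl : MeasurableSet (unitCylinder p) := hpm (measurableSet_singleton 1)
  have hae : ∀ᵐ s ∂Λ, p s = 0 → s = 0 := by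
    rw [ae_iff]
    convert hnull using 2
    ext s
    simp [and_comm]
  -- The density `p s ^ α` compensates the factor `(p s)⁻¹ ^ α` produced by the projection. Where `p
  -- s = 0` the projection gives the origin, off the cylinder, but the density is `0 ^ α = 0`.
  refine ⟨(Λ.withDensity fun s => ENNReal.ofReal (p s ^ α)).map fun s => (p s)⁻¹ • s,
    ?_, ?_, fun u => ?_⟩
  · rw [Measure.map_apply hproj hcyl.compl, withDensity_apply _ (hproj hcyl.compl),
      setLIntegral_eq_zero_iff (hproj hcyl.compl) hdens]
    refine Eventually.of_forall fun s hs => ?_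
    have hs : ¬ p ((p s)⁻¹ • s) = 1 := hs
    by_cases hps : p s = 0
    · simp [hps, Real.zero_rpow hα.ne']
    · refine absurd ?_ hs
      rw [map_smul_eq_mul, Real.norm_of_nonneg (inv_nonneg.2 (apply_nonneg p s)),
        inv_mul_cancel₀ hps]
  · intro A hA
    rw [Measure.map_apply hproj hA, Measure.map_apply hproj (measurable_neg hA),
      withDensity_apply _ (hproj hA), withDensity_apply _ (hproj (measurable_neg hA)),
      ← lintegral_indicator (hproj hA), ← lintegral_indicator (hproj (measurable_neg hA))]
    conv_rhs => rw [← hsymm.map_neg_eq, lintegral_map (hdens.indicator (hproj hA)) measurable_neg]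
    refine lintegral_congr fun s => ?_
    have hmem : s ∈ (fun s => (p s)⁻¹ • s) ⁻¹' ((fun s => -s) ⁻¹' A) ↔
        -s ∈ (fun s => (p s)⁻¹ • s) ⁻¹' A := by
      simp only [Set.mem_preimage, map_neg_eq_map, smul_neg]
    by_cases hs : -s ∈ (fun s => (p s)⁻¹ • s) ⁻¹' A
    · rw [Set.indicator_of_mem hs, Set.indicator_of_mem (hmem.2 hs), map_neg_eq_map]
    · rw [Set.indicator_of_notMem hs, Set.indicator_of_notMem (mt hmem.1 hs)]
  · have hmeas : Measurable fun s : EuclideanSpace ℝ (Fin d) => |inner ℝ u s| ^ α := by fun_prop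
    have htop : ∀ᵐ s ∂Λ, ENNReal.ofReal (p s ^ α) < ⊤ :=
      Eventually.of_forall fun s => ENNReal.ofReal_lt_top
    have heq : (fun s => (ENNReal.ofReal (p s ^ α)).toReal • |inner ℝ u ((p s)⁻¹ • s)| ^ α) =ᵐ[Λ]
        fun s => |inner ℝ u s| ^ α := by
      filter_upwards [hae] with s hs
      by_cases hps : p s = 0
      · simp [hs hps, Real.zero_rpow hα.ne']
      · have hpos : 0 < p s := lt_of_le_of_ne (apply_nonneg p s) (Ne.symm hps)
        rw [ENNReal.toReal_ofReal (by positivity), real_inner_smul_right, abs_mul,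
          Real.mul_rpow (abs_nonneg _) (abs_nonneg _), abs_of_pos (inv_pos.2 hpos),
          Real.inv_rpow hpos.le, smul_eq_mul,
          mul_inv_cancel_left₀ (Real.rpow_pos_of_pos hpos α).ne']
    obtain ⟨hint, hchar⟩ := h u
    constructor
    · rw [integrable_map_measure hmeas.aestronglyMeasurable hproj.aemeasurable,
        integrable_withDensity_iff_integrable_smul' hdens htop]
      exact hint.congr heq.symm
    · rw [integral_map hproj.aemeasurable hmeas.aestronglyMeasurable,
        integral_withDensity_eq_integral_toReal_smul hdens htop, integral_congr_ae heq, hchar]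

/-- If an SαS law with spectral measure `Λ` on `ℝᵈ` is representable on the unit cylinder of a
seminorm that vanishes on a coordinate axis, then `Λ` does not charge that axis, except possibly at
the origin. -/
theorem IsRepresentableOnCylinder.axis_null {d : ℕ} {α : ℝ} (hα₀ : 0 < α) (hα₂ : α < 2)
    {ν Λ : Measure (EuclideanSpace ℝ (Fin d))} {p : Seminorm ℝ (EuclideanSpace ℝ (Fin d))}
    (hrep : IsRepresentableOnCylinder α ν p) (h : HasSymmetricStableCharFun α ν Λ) (i : Fin d)
    (hpi : ∀ s : EuclideanSpace ℝ (Fin d), (∀ j, j ≠ i → s j = 0) → p s = 0) :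
    Λ {s | s i ≠ 0 ∧ ∀ j, j ≠ i → s j = 0} = 0 := by
  obtain ⟨Γ, hcyl, -, hΓ⟩ := hrep
  have hmeas : MeasurableSet {s : EuclideanSpace ℝ (Fin d) | ∀ j, j ≠ i → s j = 0} := by
    simp only [Set.ofPred_forall]
    exact MeasurableSet.iInter fun j => MeasurableSet.iInter fun _ =>
      measurableSet_eq_fun (by fun_prop) (by fun_prop)
  have heq : ∀ u : EuclideanSpace ℝ (Fin d),
      ∫ s, |inner ℝ u s| ^ α ∂Λ = ∫ s, |inner ℝ u s| ^ α ∂Γ := by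
    intro u
    have := (h u).2.symm.trans (hΓ u).2
    norm_cast at this
    linarith [Real.exp_injective this]
  have hzero : Γ {s | ∀ j, j ≠ i → s j = 0} = 0 := by
    refine measure_mono_null (fun s hs => ?_) hcyl
    intro hs1
    have hs1 : p s = 1 := hs1
    rw [hpi s hs] at hs1
    exact zero_ne_one hs1
  have hint := setIntegral_axis_eq_of_integral_abs_inner_rpow_eq hα₀ hα₂ (fun u => (h u).1)
    (fun u => (hΓ u).1) heq i
  have hi : Integrable (fun s : EuclideanSpace ℝ (Fin d) => |s i| ^ α) Λ := by
    simpa [EuclideanSpace.inner_single_left] using (h (EuclideanSpace.single i (1 : ℝ))).1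
  rw [Measure.restrict_eq_zero.2 hzero, integral_zero_measure,
    setIntegral_eq_zero_iff_of_nonneg_ae (Eventually.of_forall fun s => by positivity)
      hi.integrableOn] at hint
  rw [EventuallyEq, ae_restrict_iff' hmeas, ae_iff] at hint
  refine measure_mono_null (fun s hs => ?_) hint
  intro hc
  have := hc hs.2
  exact hs.1 (by simpa [Real.rpow_eq_zero (abs_nonneg _) hα₀.ne'] using this)

/-! ### Negligible remainders in characteristic functions -/

/-- As `Z n` has the law of the fixed variable `Y`, dominated convergence applies with `c n * Y → 0`
pointwise and the bound 2; no moment of `Y` is needed. -/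
lemma tendsto_integral_norm_exp_mul_I_sub_one {Ω : Type*} [MeasurableSpace Ω] {P : Measure Ω}
    [IsProbabilityMeasure P] {Y : Ω → ℝ} {Z : ℕ → Ω → ℝ} {c : ℕ → ℝ}
    (hZ : ∀ n, IdentDistrib (Z n) Y P P) (hc : Tendsto c atTop (𝓝 0)) :
    Tendsto (fun n => ∫ ω, ‖Complex.exp ((c n * Z n ω : ℝ) * Complex.I) - 1‖ ∂P) atTop (𝓝 0) := by
  have heq : ∀ n, ∫ ω, ‖Complex.exp ((c n * Z n ω : ℝ) * Complex.I) - 1‖ ∂P =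
      ∫ ω, ‖Complex.exp ((c n * Y ω : ℝ) * Complex.I) - 1‖ ∂P := fun n =>
    ((hZ n).comp (u := fun x : ℝ => ‖Complex.exp ((c n * x : ℝ) * Complex.I) - 1‖)
      (by fun_prop)).integral_eq
  simp_rw [heq]
  have hY : AEMeasurable Y P := (hZ 0).aemeasurable_snd
  rw [← integral_zero Ω ℝ (μ := P)]
  refine tendsto_integral_of_dominated_convergence (fun _ => 2) (fun n => ?_)
    (integrable_const 2) (fun n => Eventually.of_forall fun ω => ?_)
    (Eventually.of_forall fun ω => ?_)
  · exact AEMeasurable.aestronglyMeasurable (by fun_prop)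
  · rw [norm_norm]
    refine (norm_sub_le _ _).trans_eq ?_
    rw [Complex.norm_exp_ofReal_mul_I, norm_one]
    norm_num
  · have h1 : Continuous fun x : ℝ => ‖Complex.exp ((x * Y ω : ℝ) * Complex.I) - 1‖ := by fun_prop
    have h2 := (h1.tendsto 0).comp hc
    simpa [Function.comp_def] using h2

lemma tendsto_integral_exp_of_remainder {Ω : Type*} [MeasurableSpace Ω] {P : Measure Ω}
    [IsProbabilityMeasure P] {f : Ω → ℝ} {g r₁ r₂ : ℕ → Ω → ℝ} (hf : Measurable f)
    (hg : ∀ n, Measurable (g n)) (hr₁ : ∀ n, Measurable (r₁ n)) (hr₂ : ∀ n, Measurable (r₂ n))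
    (hfg : ∀ n, ∀ᵐ ω ∂P, f ω = g n ω + (r₁ n ω + r₂ n ω))
    (h₁ : Tendsto (fun n => ∫ ω, ‖Complex.exp (r₁ n ω * Complex.I) - 1‖ ∂P) atTop (𝓝 0))
    (h₂ : Tendsto (fun n => ∫ ω, ‖Complex.exp (r₂ n ω * Complex.I) - 1‖ ∂P) atTop (𝓝 0)) :
    Tendsto (fun n => ∫ ω, Complex.exp (g n ω * Complex.I) ∂P) atTop
      (𝓝 (∫ ω, Complex.exp (f ω * Complex.I) ∂P)) := by
  have hint : ∀ k : Ω → ℝ, Measurable k →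
      Integrable (fun ω => Complex.exp (k ω * Complex.I)) P := fun k hk =>
    Integrable.of_bound (Measurable.aestronglyMeasurable (by fun_prop)) 1
      (Eventually.of_forall fun ω => (Complex.norm_exp_ofReal_mul_I _).le)
  have hint' : ∀ k : Ω → ℝ, Measurable k →
      Integrable (fun ω => ‖Complex.exp (k ω * Complex.I) - 1‖) P := fun k hk =>
    ((hint k hk).sub (integrable_const 1)).norm
  rw [tendsto_iff_norm_sub_tendsto_zero]
  refine squeeze_zero (fun n => norm_nonneg _) (fun n => ?_) (by simpa using h₁.add h₂)
  rw [← integral_sub (hint _ (hg n)) (hint _ hf),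
    ← integral_add (hint' _ (hr₁ n)) (hint' _ (hr₂ n))]
  refine norm_integral_le_of_norm_le ((hint' _ (hr₁ n)).add (hint' _ (hr₂ n))) ?_
  filter_upwards [hfg n] with ω hω
  have h1 : Complex.exp (g n ω * Complex.I) - Complex.exp (f ω * Complex.I) =
      -(Complex.exp (g n ω * Complex.I) *
        (Complex.exp (r₁ n ω * Complex.I) * (Complex.exp (r₂ n ω * Complex.I) - 1) +
          (Complex.exp (r₁ n ω * Complex.I) - 1))) := by
    rw [hω]
    push_cast
    rw [add_mul, add_mul, Complex.exp_add, Complex.exp_add]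
    ring
  rw [h1, norm_neg, norm_mul, Complex.norm_exp_ofReal_mul_I, one_mul]
  refine (norm_add_le _ _).trans_eq ?_
  rw [norm_mul, Complex.norm_exp_ofReal_mul_I, one_mul, add_comm]

/-! ### Moving average representation -/

/-- The weights of the moving average representation of an AR(1) process. -/
noncomputable def arWeight (ρ : ℝ) (j : ℤ) : ℝ := if 0 ≤ j then ρ ^ j.toNat else 0

lemma arWeight_natCast (ρ : ℝ) (n : ℕ) : arWeight ρ n = ρ ^ n := by simp [arWeight]

lemma arWeight_of_neg (ρ : ℝ) {j : ℤ} (hj : j < 0) : arWeight ρ j = 0 := by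
  simp [arWeight, hj]

lemma arWeight_ne_zero {ρ : ℝ} (hρ : ρ ≠ 0) {j : ℤ} (hj : 0 ≤ j) : arWeight ρ j ≠ 0 := by
  simp [arWeight, hj, hρ]

lemma summable_abs_arWeight_rpow {α ρ : ℝ} (hα : 0 < α) (hρ : |ρ| < 1) :
    Summable fun j => |arWeight ρ j| ^ α := by
  refine Summable.of_nat_of_neg ?_ ?_
  · simp_rw [arWeight_natCast, abs_pow, ← Real.rpow_natCast_mul (abs_nonneg ρ), mul_comm _ α,
      Real.rpow_mul_natCast (abs_nonneg ρ)]
    exact summable_geometric_of_lt_one (by positivity) (Real.rpow_lt_one (abs_nonneg ρ) hρ hα)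
  · refine summable_of_ne_finset_zero (s := {0}) fun n hn => ?_
    rw [arWeight_of_neg, abs_zero, Real.zero_rpow hα.ne']
    have : n ≠ 0 := by simpa using hn
    omega

/-- Symmetric windows serve the anticipative and the causal component at once. -/
lemma sum_Icc_neg_succ (f : ℤ → ℝ) (n : ℕ) :
    ∑ j ∈ Finset.Icc (-((n + 1 : ℕ) : ℤ)) ((n + 1 : ℕ) : ℤ), f j =
      ∑ j ∈ Finset.Icc (-(n : ℤ)) n, f j + f (n + 1) + f (-(n + 1)) := by
  have : Finset.Icc (-((n + 1 : ℕ) : ℤ)) ((n + 1 : ℕ) : ℤ) =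
      insert (-((n : ℤ) + 1)) (insert ((n : ℤ) + 1) (Finset.Icc (-(n : ℤ)) n)) := by
    ext j
    simp only [Finset.mem_Icc, Finset.mem_insert]
    omega
  rw [this, Finset.sum_insert, Finset.sum_insert]
  · ring
  · simp
  · simp only [Finset.mem_insert, Finset.mem_Icc]
    omega

lemma sum_arWeight_eq {ρ : ℝ} {x e : ℤ → ℝ} (h : ∀ s, x s = ρ * x (s + 1) + e s) (t : ℤ) (n : ℕ) :
    ∑ j ∈ Finset.Icc (-(n : ℤ)) n, arWeight ρ j * e (t + j) =
      x t - ρ ^ (n + 1) * x (t + n + 1) := by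
  induction n with
  | zero => simp [arWeight, h t]
  | succ n ih =>
    rw [sum_Icc_neg_succ, ih, arWeight_of_neg ρ (j := -((n : ℤ) + 1)) (by omega),
      show arWeight ρ ((n : ℤ) + 1) = ρ ^ (n + 1) from mod_cast arWeight_natCast ρ (n + 1),
      h (t + n + 1)]
    push_cast
    rw [show t + ((n : ℤ) + 1) = t + n + 1 by ring]
    ring

lemma sum_arWeight_sub_one_eq {ρ : ℝ} {x e : ℤ → ℝ} (h : ∀ s, x s = ρ * x (s + 1) + e s) (t : ℤ)
    (n : ℕ) :
    ∑ j ∈ Finset.Icc (-(n : ℤ)) n, arWeight ρ (j - 1) * e (t + j) =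
      x (t + 1) - ρ ^ n * x (t + n + 1) := by
  induction n with
  | zero => simp [arWeight]
  | succ n ih =>
    rw [sum_Icc_neg_succ, ih, arWeight_of_neg ρ (j := -((n : ℤ) + 1) - 1) (by omega),
      add_sub_cancel_right, arWeight_natCast, h (t + n + 1)]
    push_cast
    rw [show t + ((n : ℤ) + 1) = t + n + 1 by ring]
    ring

lemma sum_arWeight_neg_eq {ρ : ℝ} {x e : ℤ → ℝ} (h : ∀ s, x s = ρ * x (s - 1) + e s) (t : ℤ)
    (n : ℕ) :
    ∑ j ∈ Finset.Icc (-(n : ℤ)) n, arWeight ρ (-j) * e (t + j) =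
      x t - ρ ^ (n + 1) * x (t - n - 1) := by
  induction n with
  | zero => simp [arWeight, h t]
  | succ n ih =>
    rw [sum_Icc_neg_succ, ih, arWeight_of_neg ρ (j := -((n : ℤ) + 1)) (by omega), neg_neg,
      show arWeight ρ ((n : ℤ) + 1) = ρ ^ (n + 1) from mod_cast arWeight_natCast ρ (n + 1),
      h (t - n - 1)]
    push_cast
    rw [show t + -((n : ℤ) + 1) = t - n - 1 by ring, show t - ((n : ℤ) + 1) = t - n - 1 by ring]
    ring

/-- The window starts at radius 1 because `ε (t + 1)` enters `X (t + 1)`; the identity would fail on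
the window `{0}`. -/
lemma sum_arWeight_one_sub_eq {ρ : ℝ} {x e : ℤ → ℝ} (h : ∀ s, x s = ρ * x (s - 1) + e s) (t : ℤ)
    (n : ℕ) :
    ∑ j ∈ Finset.Icc (-((n + 1 : ℕ) : ℤ)) ((n + 1 : ℕ) : ℤ), arWeight ρ (1 - j) * e (t + j) =
      x (t + 1) - ρ ^ (n + 3) * x (t - (n + 1 : ℕ) - 1) := by
  induction n with
  | zero =>
    have h1 := h (t + 1)
    have h2 := h t
    have h3 := h (t - 1)
    rw [add_sub_cancel_right] at h1
    rw [sum_Icc_neg_succ]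
    simp [arWeight, h1, h2, h3, ← sub_eq_add_neg]
    ring
  | succ n ih =>
    rw [sum_Icc_neg_succ, ih, arWeight_of_neg ρ (j := 1 - (((n + 1 : ℕ) : ℤ) + 1)) (by omega),
      show 1 - -(((n + 1 : ℕ) : ℤ) + 1) = ((n + 3 : ℕ) : ℤ) by push_cast; ring, arWeight_natCast,
      h (t - (n + 1 : ℕ) - 1)]
    push_cast
    rw [show t + -((n : ℤ) + 1 + 1) = t - (n + 1) - 1 by ring,
      show t - ((n : ℤ) + 1 + 1) = t - (n + 1) - 1 by ring]
    ring

/-- The linear map giving the contribution of the error `ε (t + j)` to the stacked vector at `t`. -/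
noncomputable def arFilter (ρ₁ ρ₂ : ℝ) (j : ℤ) :
    EuclideanSpace ℝ (Fin 2) →L[ℝ] EuclideanSpace ℝ (Fin 4) :=
  (EuclideanSpace.proj (0 : Fin 2) : EuclideanSpace ℝ (Fin 2) →L[ℝ] ℝ).smulRight
      !₂[arWeight ρ₁ j, 0, arWeight ρ₁ (j - 1), 0] +
    (EuclideanSpace.proj (1 : Fin 2) : EuclideanSpace ℝ (Fin 2) →L[ℝ] ℝ).smulRight
      !₂[0, arWeight ρ₂ (-j), 0, arWeight ρ₂ (1 - j)]

lemma arFilter_apply (ρ₁ ρ₂ : ℝ) (j : ℤ) (s : EuclideanSpace ℝ (Fin 2)) :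
    arFilter ρ₁ ρ₂ j s = !₂[arWeight ρ₁ j * s 0, arWeight ρ₂ (-j) * s 1,
      arWeight ρ₁ (j - 1) * s 0, arWeight ρ₂ (1 - j) * s 1] := by
  ext i
  fin_cases i <;> simp [arFilter, mul_comm]

/-- A substitute for the triangle inequality that treats `α < 1` and `α ≥ 1` alike, via `|x + y| ≤ 2
* max |x| |y|`. -/
lemma abs_add_rpow_le_two_rpow_mul {α : ℝ} (hα : 0 ≤ α) (x y : ℝ) :
    |x + y| ^ α ≤ 2 ^ α * (|x| ^ α + |y| ^ α) := by
  have h1 : |x + y| ≤ 2 * max |x| |y| := by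
    refine (abs_add_le x y).trans ?_
    linarith [le_max_left |x| |y|, le_max_right |x| |y|]
  refine (Real.rpow_le_rpow (abs_nonneg _) h1 hα).trans ?_
  rw [Real.mul_rpow (by norm_num) (by positivity)]
  refine mul_le_mul_of_nonneg_left ?_ (by positivity)
  have hx : 0 ≤ |x| ^ α := by positivity
  have hy : 0 ≤ |y| ^ α := by positivity
  rcases max_cases |x| |y| with h | h <;> rw [h.1] <;> linarith

lemma Summable.abs_add_rpow {ι : Type*} {α : ℝ} (hα : 0 ≤ α) {f g : ι → ℝ}
    (hf : Summable fun i => |f i| ^ α) (hg : Summable fun i => |g i| ^ α) :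
    Summable fun i => |f i + g i| ^ α :=
  ((hf.add hg).mul_left (2 ^ α)).of_nonneg_of_le (fun _ => by positivity)
    fun i => abs_add_rpow_le_two_rpow_mul hα (f i) (g i)

lemma Summable.abs_const_mul_rpow {ι : Type*} {α : ℝ} {f : ι → ℝ}
    (hf : Summable fun i => |f i| ^ α) (c : ℝ) : Summable fun i => |c * f i| ^ α := by
  simp_rw [abs_mul, Real.mul_rpow (abs_nonneg _) (abs_nonneg _)]
  exact hf.mul_left _

lemma inner_arFilter (ρ₁ ρ₂ : ℝ) (j : ℤ) (u : EuclideanSpace ℝ (Fin 4))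
    (s : EuclideanSpace ℝ (Fin 2)) :
    inner ℝ u (arFilter ρ₁ ρ₂ j s) =
      (u 0 * arWeight ρ₁ j + u 2 * arWeight ρ₁ (j - 1)) * s 0 +
        (u 1 * arWeight ρ₂ (-j) + u 3 * arWeight ρ₂ (1 - j)) * s 1 := by
  rw [arFilter_apply, PiLp.inner_apply, Fin.sum_univ_four]
  simp
  ring

lemma summable_integral_abs_inner_arFilter_rpow {α ρ₁ ρ₂ : ℝ} (hα : 0 < α) (hρ₁ : |ρ₁| < 1)
    (hρ₂ : |ρ₂| < 1) {Γ : Measure (EuclideanSpace ℝ (Fin 2))}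
    (hΓ : ∀ u : EuclideanSpace ℝ (Fin 2), Integrable (fun s => |inner ℝ u s| ^ α) Γ)
    (u : EuclideanSpace ℝ (Fin 4)) :
    Summable fun j => ∫ s, |inner ℝ u s| ^ α ∂Γ.map (arFilter ρ₁ ρ₂ j) := by
  have hi : ∀ i : Fin 2, Integrable (fun s : EuclideanSpace ℝ (Fin 2) => |s i| ^ α) Γ := fun i => by
    simpa [EuclideanSpace.inner_single_left] using hΓ (EuclideanSpace.single i (1 : ℝ))
  have hw₁ := summable_abs_arWeight_rpow hα hρ₁
  have hw₂ := summable_abs_arWeight_rpow hα hρ₂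
  have ha : Summable fun j => |u 0 * arWeight ρ₁ j + u 2 * arWeight ρ₁ (j - 1)| ^ α :=
    (hw₁.abs_const_mul_rpow _).abs_add_rpow hα.le
      (((Equiv.subRight (1 : ℤ)).summable_iff.2 hw₁).abs_const_mul_rpow (f := fun j =>
        arWeight ρ₁ (j - 1)) _)
  have hb : Summable fun j => |u 1 * arWeight ρ₂ (-j) + u 3 * arWeight ρ₂ (1 - j)| ^ α :=
    (((Equiv.neg ℤ).summable_iff.2 hw₂).abs_const_mul_rpow (f := fun j => arWeight ρ₂ (-j))
      _).abs_add_rpow hα.le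
      (((Equiv.subLeft (1 : ℤ)).summable_iff.2 hw₂).abs_const_mul_rpow (f := fun j =>
        arWeight ρ₂ (1 - j)) _)
  refine (((ha.mul_right (∫ s, |s 0| ^ α ∂Γ)).add
    (hb.mul_right (∫ s, |s 1| ^ α ∂Γ))).mul_left (2 ^ α)).of_nonneg_of_le
    (fun j => integral_nonneg fun s => by positivity) fun j => ?_
  rw [integral_map (arFilter ρ₁ ρ₂ j).measurable.aemeasurable
    (Measurable.aestronglyMeasurable (by fun_prop)), ← integral_const_mul, ← integral_const_mul,
    ← integral_add ((hi 0).const_mul _) ((hi 1).const_mul _), ← integral_const_mul]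
  refine integral_mono_of_nonneg (Eventually.of_forall fun s => by positivity)
    ((((hi 0).const_mul _).add ((hi 1).const_mul _)).const_mul _)
    (Eventually.of_forall fun s => ?_)
  simp only [inner_arFilter, ← Real.mul_rpow (abs_nonneg _) (abs_nonneg _), ← abs_mul]
  exact abs_add_rpow_le_two_rpow_mul hα.le _ _

/-- Both coordinates of a component leave a remainder at the same time point, so each remainder is
one real variable times a fixed vector, and stationarity of one-dimensional marginals suffices. -/
lemma sum_arFilter_eq {ρ₁ ρ₂ : ℝ} {x e : ℤ → EuclideanSpace ℝ (Fin 2)}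
    (h₁ : ∀ s, x s 0 = ρ₁ * x (s + 1) 0 + e s 0) (h₂ : ∀ s, x s 1 = ρ₂ * x (s - 1) 1 + e s 1)
    (t : ℤ) (n : ℕ) :
    !₂[x t 0, x t 1, x (t + 1) 0, x (t + 1) 1] =
      ∑ j ∈ Finset.Icc (-((n + 1 : ℕ) : ℤ)) ((n + 1 : ℕ) : ℤ), arFilter ρ₁ ρ₂ j (e (t + j)) +
        (x (t + (n + 1 : ℕ) + 1) 0 • ρ₁ ^ (n + 1) • !₂[ρ₁, 0, 1, 0] +
          x (t - (n + 1 : ℕ) - 1) 1 • ρ₂ ^ (n + 2) • !₂[0, 1, 0, ρ₂]) := by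
  have e₁ := sum_arWeight_eq (x := fun s => x s 0) (e := fun s => e s 0) h₁ t (n + 1)
  have e₂ := sum_arWeight_neg_eq (x := fun s => x s 1) (e := fun s => e s 1) h₂ t (n + 1)
  have e₃ := sum_arWeight_sub_one_eq (x := fun s => x s 0) (e := fun s => e s 0) h₁ t (n + 1)
  have e₄ := sum_arWeight_one_sub_eq (x := fun s => x s 1) (e := fun s => e s 1) h₂ t n
  beta_reduce at e₁ e₂ e₃ e₄
  generalize ((n + 1 : ℕ) : ℤ) = m at *
  ext i
  fin_cases i
  · simp [arFilter_apply, e₁]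
    ring
  · simp [arFilter_apply, e₂]
    ring
  · simp [arFilter_apply, e₃]
    ring
  · simp [arFilter_apply, e₄]
    ring

lemma IsStrictlyStationary.identDistrib {Ω E : Type*} [MeasurableSpace Ω] [MeasurableSpace E]
    {P : Measure Ω} {X : ℤ → Ω → E} (h : IsStrictlyStationary P X) (s : ℤ) :
    IdentDistrib (X s) (X 0) P P := by
  have := (h s).comp (u := fun x : ℤ → E => x 0) (measurable_pi_apply 0)
  simpa [Function.comp_def] using this

lemma measurable_stackedVector {Ω : Type*} [MeasurableSpace Ω]
    {X : ℤ → Ω → EuclideanSpace ℝ (Fin 2)} (hX : ∀ t, Measurable (X t)) (t : ℤ) :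
    Measurable (stackedVector X t) := by
  have h : ∀ s (i : Fin 2), Measurable fun ω => X s ω i := fun s i => by
    have := hX s
    fun_prop
  refine (WithLp.measurable_toLp 2 _).comp (measurable_pi_iff.2 fun i => ?_)
  fin_cases i
  exacts [h t 0, h t 1, h (t + 1) 0, h (t + 1) 1]

/-! ### Spectral measure of the stacked vector -/

/-- The spectral measure on `ℝ⁴` of the stacked vector, not normalised to a sphere. -/
noncomputable def stackedSpectralMeasure (ρ₁ ρ₂ : ℝ) (Γ : Measure (EuclideanSpace ℝ (Fin 2))) :
    Measure (EuclideanSpace ℝ (Fin 4)) :=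
  Measure.sum fun j => Γ.map (arFilter ρ₁ ρ₂ j)

theorem IsBivariateStableAR1.hasSymmetricStableCharFun {Ω : Type*} [MeasurableSpace Ω]
    {P : Measure Ω} [IsProbabilityMeasure P] {α ρ₁ ρ₂ : ℝ} (hα : 0 < α) (hρ₁ : |ρ₁| < 1)
    (hρ₂ : |ρ₂| < 1) {Γ₂ : Measure (EuclideanSpace ℝ (Fin 2))}
    {ε X : ℤ → Ω → EuclideanSpace ℝ (Fin 2)} (hX : IsBivariateStableAR1 P α ρ₁ ρ₂ Γ₂ ε X) (t : ℤ) :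
    HasSymmetricStableCharFun α (P.map (stackedVector X t))
      (stackedSpectralMeasure ρ₁ ρ₂ Γ₂) := by
  have hterm : ∀ j, HasSymmetricStableCharFun α (P.map fun ω => arFilter ρ₁ ρ₂ j (ε (t + j) ω))
      (Γ₂.map (arFilter ρ₁ ρ₂ j)) := by
    intro j
    have := (hX.law_error (t + j)).charFun_eq.map (arFilter ρ₁ ρ₂ j)
    rwa [Measure.map_map (arFilter ρ₁ ρ₂ j).measurable (hX.measurable_error _)] at this
  have hmeas : ∀ j, Measurable fun ω => arFilter ρ₁ ρ₂ j (ε (t + j) ω) := fun j =>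
    (arFilter ρ₁ ρ₂ j).measurable.comp (hX.measurable_error _)
  have hindep : iIndepFun (fun j ω => arFilter ρ₁ ρ₂ j (ε (t + j) ω)) P :=
    (hX.indep_error.precomp (add_right_injective t)).comp (fun j => arFilter ρ₁ ρ₂ j)
      fun j => (arFilter ρ₁ ρ₂ j).measurable
  have hXi : ∀ s (i : Fin 2), Measurable fun ω => X s ω i := fun s i => by
    have := hX.measurable s
    fun_prop
  have hS := measurable_stackedVector hX.measurable t
  refine HasSymmetricStableCharFun.sum_of_tendsto
    (J := fun n => Finset.Icc (-((n + 1 : ℕ) : ℤ)) ((n + 1 : ℕ) : ℤ))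
    (Finset.tendsto_Icc_neg.comp (tendsto_add_atTop_nat 1)) (fun j u => (hterm j u).1)
    (summable_integral_abs_inner_arFilter_rpow hα hρ₁ hρ₂
      fun u => ((hX.law_error 0).charFun_eq u).1) fun u => ?_
  have hident : ∀ (s : ℤ) (i : Fin 2),
      IdentDistrib (fun ω => X s ω i) (fun ω => X 0 ω i) P P := fun s i =>
    (hX.stationary.identDistrib s).comp (u := fun x : EuclideanSpace ℝ (Fin 2) => x i)
      (by fun_prop)
  have hpow : ∀ {ρ : ℝ} (_ : |ρ| < 1) (k : ℕ) (c : ℝ),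
      Tendsto (fun n : ℕ => ρ ^ (n + k) * c) atTop (𝓝 0) := fun hρ k c => by
    simpa using ((tendsto_pow_atTop_nhds_zero_of_abs_lt_one hρ).comp
      (tendsto_add_atTop_nat k)).mul_const c
  have key := tendsto_integral_exp_of_remainder (P := P)
    (f := fun ω => inner ℝ (stackedVector X t ω) u)
    (g := fun n ω => inner ℝ (∑ j ∈ Finset.Icc (-((n + 1 : ℕ) : ℤ)) ((n + 1 : ℕ) : ℤ),
      arFilter ρ₁ ρ₂ j (ε (t + j) ω)) u)
    (r₁ := fun n ω => ρ₁ ^ (n + 1) * inner ℝ !₂[ρ₁, 0, 1, 0] u * X (t + (n + 1 : ℕ) + 1) ω 0)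
    (r₂ := fun n ω => ρ₂ ^ (n + 2) * inner ℝ !₂[0, 1, 0, ρ₂] u * X (t - (n + 1 : ℕ) - 1) ω 1)
    (by fun_prop) (fun n => by fun_prop) (fun n => (hXi _ 0).const_mul _)
    (fun n => (hXi _ 1).const_mul _) (fun n => ?_)
    (tendsto_integral_norm_exp_mul_I_sub_one (fun n => hident _ 0) (hpow hρ₁ 1 _))
    (tendsto_integral_norm_exp_mul_I_sub_one (fun n => hident _ 1) (hpow hρ₂ 2 _))
  · rw [charFun_apply, integral_map hS.aemeasurable
      (Measurable.aestronglyMeasurable (by fun_prop))]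
    refine key.congr fun n => ?_
    -- By independence, the product of exponentials is the characteristic function of the partial
    -- sum.
    simp_rw [← fun j => (hterm j u).2]
    rw [← Finset.prod_apply, ← (hindep.restrict _).charFun_map_fun_finsetSum_eq_prod
      fun j _ => (hmeas j).aemeasurable, charFun_apply, integral_map
      (Measurable.aemeasurable (by fun_prop)) (Measurable.aestronglyMeasurable (by fun_prop))]
  · filter_upwards [ae_all_iff.2 hX.anticipative, ae_all_iff.2 hX.causal] with ω h₁ h₂
    rw [stackedVector, sum_arFilter_eq (x := fun s => X s ω) (e := fun s => ε s ω) h₁ h₂ t n]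
    simp only [inner_add_left, real_inner_smul_left]
    ring

/-! ### Mass of the kernel of the seminorm, and conclusion -/

lemma presentSeminorm_apply (x : EuclideanSpace ℝ (Fin 4)) :
    presentSeminorm x = √(x 0 ^ 2 + x 1 ^ 2) := rfl

lemma continuous_presentSeminorm : Continuous presentSeminorm := by
  have : (presentSeminorm : EuclideanSpace ℝ (Fin 4) → ℝ) = fun x => √(x 0 ^ 2 + x 1 ^ 2) := rfl
  rw [this]
  fun_prop

lemma presentSeminorm_eq_zero_iff (x : EuclideanSpace ℝ (Fin 4)) :
    presentSeminorm x = 0 ↔ x 0 = 0 ∧ x 1 = 0 := by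
  rw [presentSeminorm_apply, Real.sqrt_eq_zero (by positivity),
    add_eq_zero_iff_of_nonneg (sq_nonneg _) (sq_nonneg _)]
  simp

lemma eq_zero_one_of_mem_sphere {s : EuclideanSpace ℝ (Fin 2)}
    (hs : s ∈ Metric.sphere (0 : EuclideanSpace ℝ (Fin 2)) 1) (h0 : s 0 = 0) :
    s ∈ ({!₂[(0 : ℝ), -1], !₂[(0 : ℝ), 1]} : Set (EuclideanSpace ℝ (Fin 2))) := by
  rw [mem_sphere_zero_iff_norm, EuclideanSpace.norm_eq, Fin.sum_univ_two, h0, Real.sqrt_eq_one] at hs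
  have h1 : s 1 = 1 ∨ s 1 = -1 := sq_eq_one_iff.1 (by simpa using hs)
  rcases h1 with h1 | h1
  · right
    ext i
    fin_cases i <;> simp [h0, h1]
  · left
    ext i
    fin_cases i <;> simp [h0, h1]

lemma stackedSpectralMeasure_null {ρ₁ ρ₂ : ℝ} (hρ₁ : ρ₁ ≠ 0) (hρ₂ : ρ₂ ≠ 0)
    {Γ : Measure (EuclideanSpace ℝ (Fin 2))}
    (hsphere : Γ (Metric.sphere (0 : EuclideanSpace ℝ (Fin 2)) 1)ᶜ = 0)
    (hΓ : Γ {!₂[(0 : ℝ), -1], !₂[(0 : ℝ), 1]} = 0) :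
    stackedSpectralMeasure ρ₁ ρ₂ Γ {s | s ≠ 0 ∧ presentSeminorm s = 0} = 0 := by
  have hmeas : MeasurableSet {s : EuclideanSpace ℝ (Fin 4) | s ≠ 0 ∧ presentSeminorm s = 0} :=
    (measurableSet_singleton 0).compl.inter
      (continuous_presentSeminorm.measurable (measurableSet_singleton 0))
  rw [stackedSpectralMeasure, Measure.sum_apply _ hmeas, ENNReal.tsum_eq_zero]
  intro j
  rw [Measure.map_apply (arFilter ρ₁ ρ₂ j).measurable hmeas]
  refine measure_mono_null (fun s hs => ?_) (measure_union_null hsphere hΓ)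
  obtain ⟨hne, hp⟩ := hs
  rw [presentSeminorm_eq_zero_iff, arFilter_apply] at hp
  simp only [Matrix.cons_val_zero, Matrix.cons_val_one, mul_eq_zero] at hp
  by_cases hs : s ∈ Metric.sphere (0 : EuclideanSpace ℝ (Fin 2)) 1
  · right
    refine eq_zero_one_of_mem_sphere hs ?_
    rcases hp.1 with hj | h0
    -- For `j < 0` only the causal component contributes, with nonzero weight at time `t`; hence `s
    -- 1 = 0` and the whole image is zero, which is excluded.
    · have hj' : j < 0 := by
        by_contra hj'
        exact arWeight_ne_zero hρ₁ (not_lt.1 hj') hj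
      have h1 : s 1 = 0 := hp.2.resolve_left (arWeight_ne_zero hρ₂ (by omega))
      refine absurd ?_ hne
      rw [arFilter_apply, h1, arWeight_of_neg ρ₁ hj', arWeight_of_neg ρ₁ (by omega : j - 1 < 0)]
      ext i
      fin_cases i <;> simp
    · exact h0
  · exact Or.inl hs

/-- The summand `j = 1` suffices: it maps `(0, ±1)` to `(0, 0, 0, ±1)`. -/
lemma null_of_stackedSpectralMeasure_axis_null {ρ₁ ρ₂ : ℝ}
    {Γ : Measure (EuclideanSpace ℝ (Fin 2))}
    (h : stackedSpectralMeasure ρ₁ ρ₂ Γ {s | s 3 ≠ 0 ∧ ∀ j, j ≠ 3 → s j = 0} = 0) :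
    Γ {!₂[(0 : ℝ), -1], !₂[(0 : ℝ), 1]} = 0 := by
  have h1 := le_antisymm ((Measure.le_sum (fun j => Γ.map (arFilter ρ₁ ρ₂ j)) 1 _).trans_eq h)
    zero_le
  have h2 := (Measure.le_map_apply (arFilter ρ₁ ρ₂ 1).measurable.aemeasurable _).trans_eq h1
  refine measure_mono_null (fun s hs => ?_) (le_antisymm h2 zero_le)
  rw [Set.mem_preimage, Set.mem_ofPred_eq, arFilter_apply]
  rcases hs with rfl | rfl
  · refine ⟨by simp [arWeight], fun j hj => ?_⟩
    fin_cases j <;> simp_all [arWeight]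
  · refine ⟨by simp [arWeight], fun j hj => ?_⟩
    fin_cases j <;> simp_all [arWeight]

theorem proposition8 {Ω : Type*} [MeasurableSpace Ω] (P : Measure Ω) [IsProbabilityMeasure P]
    (α ρ₁ ρ₂ : ℝ) (hα₀ : 0 < α) (hα₂ : α < 2)
    (hρ₁ : 0 < |ρ₁|) (hρ₁' : |ρ₁| < 1) (hρ₂ : 0 < |ρ₂|) (hρ₂' : |ρ₂| < 1)
    (Γ₂ : Measure (EuclideanSpace ℝ (Fin 2)))
    (ε X : ℤ → Ω → EuclideanSpace ℝ (Fin 2))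
    (hX : IsBivariateStableAR1 P α ρ₁ ρ₂ Γ₂ ε X) (t : ℤ) :
    IsSymmetricAlphaStable α (P.map (stackedVector X t)) ∧
      (IsRepresentableOnCylinder α (P.map (stackedVector X t)) presentSeminorm ↔
        Γ₂ {!₂[(0 : ℝ), -1], !₂[(0 : ℝ), 1]} = 0) := by
  have hchar := hX.hasSymmetricStableCharFun hα₀ hρ₁' hρ₂' t
  have : IsProbabilityMeasure (P.map (stackedVector X t)) :=
    Measure.isProbabilityMeasure_map (measurable_stackedVector hX.measurable t).aemeasurable
  have hsymm : IsSymmetricMeasure (stackedSpectralMeasure ρ₁ ρ₂ Γ₂) :=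
    IsSymmetricMeasure.sum fun j => (hX.law_error 0).symmetric.map (arFilter ρ₁ ρ₂ j)
  refine ⟨hchar.isSymmetricAlphaStable hα₀, fun hrep => ?_, fun hnull => ?_⟩
  · refine null_of_stackedSpectralMeasure_axis_null (hrep.axis_null hα₀ hα₂ hchar 3 fun s hs => ?_)
    exact (presentSeminorm_eq_zero_iff s).2 ⟨hs 0 (by decide), hs 1 (by decide)⟩
  · exact hchar.isRepresentableOnCylinder hα₀ hsymm continuous_presentSeminorm
      (stackedSpectralMeasure_null (abs_pos.1 hρ₁) (abs_pos.1 hρ₂)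
        (hX.law_error 0).on_sphere hnull)
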